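/- Let $M$ be a smooth $n$-dimensional manifold (without boundary) with a smooth pseudo-Riemannian metric $g$ of arbitrary signature $\eta=\mathrm{diag}(\pm1,\dots,\pm1)$ and with a spin structure, given by local $g$-orthonormal frames $e^i_1,\dots,e^i_n$ on an open cover $(U_i)$ and transition functions $s_{ij}$ with values in the spin group of $\eta$ (here: even products $s$ of nonnull vectors of spinor norm $1$, a double cover of the identity component $SO_0(\eta)$; so for indefinite $\eta$ the manifold is oriented in space and time) covering those of the frames. Let $\gamma_a$ be the gamma matrices of a representation $\rho$ of the Clifford algebra of $\eta$ on $\mathbb{C}^N$, with $\gamma_a\gamma_b+\gamma_b\gamma_a=2\eta_{ab}$ (for Dirac spinors, the irreducible one). A spinor field $\psi$ is a smooth section of the associated spinor bundle, and in each local spin frame the Dirac operator is $$D\psi=\sum_a\gamma^a\Big(e_a(\psi)+\tfrac14\sum_{b,c}g(e_b,\nabla_{e_a}e_c)\,\gamma^b\gamma^c\psi\Big),$$ where $\nabla$ is the Levi-Civita connection of $g$ and $\gamma^a=\eta_{aa}\gamma_a$. Let $\Omega>0$ be a smooth function on $M$ and $\tilde g=\Omega^2g$. The spinor bundle of $(M,\tilde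 g)$, formed with the frames $\Omega^{-1}e^i_a$ and the same $s_{ij}$, is identified with that of $(M,g)$; let $\tilde D$ be its Dirac operator. For a spinor field $\psi$ put $\tilde\psi=\Omega^{-(n-1)/2}\psi$. Then: 1. $\tilde D\tilde\psi=\Omega^{-(n+1)/2}D\psi$ for every spinor field $\psi$. 2. If $D\psi=0$, then $\tilde D\tilde\psi=0$. 3. Let $\bar\phi=\phi^\dagger A$ be a Dirac conjugation, that is, $A$ is an invertible matrix such that $\bar\phi\psi$ is invariant under the spin group. Let $\sigma$ be an immersed hypersurface of $M$ (of dimension $n-1$), and let $d\sigma$, $d\tilde\sigma$ be the volume measures of the metrics that $g$, $\tilde g$ induce on it (with density $\sqrt{|\det h|}$ in charts, for the induced metric $h$). Then for all spinor fields $\phi,\psi$ $$\int_\sigma\bar{\tilde\phi}\,\tilde\psi\,d\tilde\sigma=\int_\sigma\bar\phi\,\psi\,d\sigma ,$$ and one integrand is integrable if and only if the other is. If $T$ is a unit normal field along $\sigma$ for $g$ (with $g(T,T)=\pm1$), then $\tilde T=\Omega^{-1}T$ is one for $\tilde g$ (with the same sign), and likewise, with $\gamma\cdot T=\sum_a T^a\gamma_a$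 for the components $T^a$ of $T$ in $e_1,\dots,e_n$, and $\tilde\gamma\cdot\tilde T$ formed in the same way in the frame $\Omega^{-1}e_1,\dots,\Omega^{-1}e_n$, $$\int_\sigma\bar{\tilde\phi}\,(\tilde\gamma\cdot\tilde T)\,\tilde\psi\,d\tilde\sigma=\int_\sigma\bar\phi\,(\gamma\cdot T)\,\psi\,d\sigma ,$$ again with one integrand integrable if and only if the other is. -/

import Mathlib

open scoped Manifold ContDiff Bundle Matrix

noncomputable section

/-! ### Pseudo-Riemannian metrics and the Levi-Civita connection -/

/-- A smooth pseudo-Riemannian metric (of arbitrary signature) on an `n`-dimensional manifold. -/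
structure PseudoRiemannianMetric (n : ℕ) (M : Type*) [TopologicalSpace M]
    [ChartedSpace (EuclideanSpace ℝ (Fin n)) M] [IsManifold (𝓡 n) ∞ M] where
  val (x : M) : TangentSpace (𝓡 n) x →L[ℝ] TangentSpace (𝓡 n) x →L[ℝ] ℝ
  symm (x : M) (v w : TangentSpace (𝓡 n) x) : val x v w = val x w v
  nondegenerate (x : M) (v : TangentSpace (𝓡 n) x) (hv : ∀ w, val x v w = 0) : v = 0
  contMDiff : ContMDiff (𝓡 n)
    ((𝓡 n).prod 𝓘(ℝ, EuclideanSpace ℝ (Fin n) →L[ℝ] EuclideanSpace ℝ (Fin n) →L[ℝ] ℝ)) ∞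
    (fun x ↦ Bundle.TotalSpace.mk'
      (EuclideanSpace ℝ (Fin n) →L[ℝ] EuclideanSpace ℝ (Fin n) →L[ℝ] ℝ)
      (E := fun x : M ↦ TangentSpace (𝓡 n) x →L[ℝ] TangentSpace (𝓡 n) x →L[ℝ] ℝ) x (val x))

namespace PseudoRiemannianMetric

variable {n : ℕ} {M : Type*} [TopologicalSpace M]
  [ChartedSpace (EuclideanSpace ℝ (Fin n)) M] [IsManifold (𝓡 n) ∞ M]

/-- The conformally related metric `Ω² g`. -/
def conformal (g : PseudoRiemannianMetric n M) (Ω : M → ℝ)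
    (hΩ : ContMDiff (𝓡 n) 𝓘(ℝ) ∞ Ω) (hpos : ∀ x, 0 < Ω x) : PseudoRiemannianMetric n M where
  val x := (Ω x) ^ 2 • g.val x
  symm x v w := by simp [g.symm x v w]
  nondegenerate x v hv := g.nondegenerate x v fun w ↦ by
    have := hv w
    simpa [(hpos x).ne'] using this
  contMDiff := (hΩ.pow 2).smul_section g.contMDiff

/-- The Levi-Civita connection of `g`, given by the Koszul formula: this is `g(∇_X Y, Z)` at `x`. -/
def leviCivita (g : PseudoRiemannianMetric n M) (X Y Z : Π x : M, TangentSpace (𝓡 n) x)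
    (x : M) : ℝ :=
  (mvfderiv (𝓡 n) (fun y ↦ g.val y (Y y) (Z y)) x (X x)
    + mvfderiv (𝓡 n) (fun y ↦ g.val y (Z y) (X y)) x (Y x)
    - mvfderiv (𝓡 n) (fun y ↦ g.val y (X y) (Y y)) x (Z x)
    + g.val x (VectorField.mlieBracket (𝓡 n) X Y x) (Z x)
    - g.val x (VectorField.mlieBracket (𝓡 n) Y Z x) (X x)
    + g.val x (VectorField.mlieBracket (𝓡 n) Z X x) (Y x)) / 2

end PseudoRiemannianMetric

/-! ### Clifford algebra and spin structures -/

/-- The standard quadratic form `v ↦ ∑ a, η a * v a ^ 2`, where `η a = ±1`, on `ℝⁿ`. -/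
abbrev signQuadraticForm {n : ℕ} (η : Fin n → ℤˣ) : QuadraticForm ℝ (Fin n → ℝ) :=
  QuadraticMap.weightedSumSquares ℝ (fun a ↦ ((η a : ℤ) : ℝ))

/-- A spin structure on `(M, g)`, where `g` has signature `η`, given by a spin frame cocycle:
an open cover `U i` with smooth `g`-orthonormal frames `e i`, and smooth transition functions
`s i j` with values in the spin group which satisfy the cocycle condition and cover the transition
functions of the frames, i.e. `s i j * v * (s i j)⁻¹ = v'` if `v`, `v'` are the components of the
same tangent vector in the frames `e j`, `e i`.

The spin group is the one of Mathlib: products of nonnull vectors that are even and satisfy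
`star s * s = 1`. It maps onto the identity component of the orthogonal group of `η`, so `M` is
oriented and, in indefinite signature, oriented in space and in time. -/
structure SpinStructure {n : ℕ} {M : Type*} [TopologicalSpace M]
    [ChartedSpace (EuclideanSpace ℝ (Fin n)) M] [IsManifold (𝓡 n) ∞ M]
    (g : PseudoRiemannianMetric n M) (η : Fin n → ℤˣ) (ι : Type*) where
  U : ι → Set M
  isOpen_U (i : ι) : IsOpen (U i)
  cover (x : M) : ∃ i, x ∈ U i
  e : ι → Fin n → Π x : M, TangentSpace (𝓡 n) x
  smooth_e (i : ι) (a : Fin n) : ContMDiffOn (𝓡 n) (𝓡 n).tangent ∞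
    (fun x ↦ (⟨x, e i a x⟩ : TangentBundle (𝓡 n) M)) (U i)
  orthonormal (i : ι) (x : M) (hx : x ∈ U i) (a b : Fin n) :
    g.val x (e i a x) (e i b x) = if a = b then ((η a : ℤ) : ℝ) else 0
  s : ι → ι → M → CliffordAlgebra (signQuadraticForm η)
  mem_spin (i j : ι) (x : M) (hi : x ∈ U i) (hj : x ∈ U j) :
    s i j x ∈ spinGroup (signQuadraticForm η)
  /-- Smoothness of a map into the finite-dimensional space `CliffordAlgebra _`, tested on linear
  functionals. -/
  smooth_s (i j : ι) (l : CliffordAlgebra (signQuadraticForm η) →ₗ[ℝ] ℝ) :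
    ContMDiffOn (𝓡 n) 𝓘(ℝ) ∞ (fun x ↦ l (s i j x)) (U i ∩ U j)
  cocycle (i j k : ι) (x : M) (hi : x ∈ U i) (hj : x ∈ U j) (hk : x ∈ U k) :
    s i j x * s j k x = s i k x
  frame_trans (i j : ι) (x : M) (hi : x ∈ U i) (hj : x ∈ U j) (v' v : Fin n → ℝ)
    (h : ∑ a, v' a • e i a x = ∑ a, v a • e j a x) :
    s i j x * CliffordAlgebra.ι (signQuadraticForm η) v
      = CliffordAlgebra.ι (signQuadraticForm η) v' * s i j x

namespace SpinStructure

variable {n : ℕ} {M : Type*} [TopologicalSpace M]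
  [ChartedSpace (EuclideanSpace ℝ (Fin n)) M] [IsManifold (𝓡 n) ∞ M]
  {g : PseudoRiemannianMetric n M} {η : Fin n → ℤˣ} {ι : Type*}

/-- The spin structure on `(M, Ω² g)` that corresponds to one on `(M, g)`: the frames are rescaled
by `Ω⁻¹`, with the same spin transition functions. -/
def conformal (σ : SpinStructure g η ι) (Ω : M → ℝ)
    (hΩ : ContMDiff (𝓡 n) 𝓘(ℝ) ∞ Ω) (hpos : ∀ x, 0 < Ω x) :
    SpinStructure (g.conformal Ω hΩ hpos) η ι where
  U := σ.U
  isOpen_U := σ.isOpen_U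
  cover := σ.cover
  e i a x := (Ω x)⁻¹ • σ.e i a x
  smooth_e i a := (hΩ.inv₀ fun x ↦ (hpos x).ne').contMDiffOn.smul_section (σ.smooth_e i a)
  orthonormal i x hx a b := by
    have h := σ.orthonormal i x hx a b
    have h0 := (hpos x).ne'
    simp only [PseudoRiemannianMetric.conformal, map_smul, smul_apply, h, smul_eq_mul]
    field_simp
  s := σ.s
  mem_spin := σ.mem_spin
  smooth_s := σ.smooth_s
  cocycle := σ.cocycle
  frame_trans i j x hi hj v' v h := σ.frame_trans i j x hi hj v' v <| by
    have h0 := (hpos x).ne'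
    have h1 (c : Fin n → ℝ) (k : ι) :
        ∑ a, c a • (Ω x)⁻¹ • σ.e k a x = (Ω x)⁻¹ • ∑ a, c a • σ.e k a x := by
      rw [Finset.smul_sum]
      exact Finset.sum_congr rfl fun a _ ↦ smul_comm _ _ _
    rw [h1, h1] at h
    exact smul_right_injective _ (inv_ne_zero h0) h

/-- The spin connection coefficients `ω_{abc} = g(e_b, ∇_{e_a} e_c)` in the frame `e i`. -/
def spinConnection (σ : SpinStructure g η ι) (i : ι) (a b c : Fin n) (x : M) : ℝ :=
  g.leviCivita (σ.e i a) (σ.e i c) (σ.e i b) x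

end SpinStructure

/-! ### Spinor fields and the Dirac operator

Spinors take values in `ℂᴺ` with a complex representation `ρ` of the (real) Clifford algebra.
Dirac spinors are the case in which `ρ` is irreducible. -/

/-- The gamma matrices `γ_a`, which satisfy `γ_a γ_b + γ_b γ_a = 2 η_{ab}`. -/
def gammaMatrix {n N : ℕ} {η : Fin n → ℤˣ}
    (ρ : CliffordAlgebra (signQuadraticForm η) →ₐ[ℝ] Matrix (Fin N) (Fin N) ℂ) (a : Fin n) :
    Matrix (Fin N) (Fin N) ℂ :=
  ρ (CliffordAlgebra.ι (signQuadraticForm η) (Pi.single a 1))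

/-- A smooth section of the spinor bundle which is associated to the spin structure `σ` by `ρ`,
given by its components in the spin frames. -/
structure SpinorField {n N : ℕ} {M : Type*} [TopologicalSpace M]
    [ChartedSpace (EuclideanSpace ℝ (Fin n)) M] [IsManifold (𝓡 n) ∞ M]
    {g : PseudoRiemannianMetric n M} {η : Fin n → ℤˣ} {ι : Type*} (σ : SpinStructure g η ι)
    (ρ : CliffordAlgebra (signQuadraticForm η) →ₐ[ℝ] Matrix (Fin N) (Fin N) ℂ) where
  comp : ι → M → (Fin N → ℂ)
  smooth (i : ι) : ContMDiffOn (𝓡 n) 𝓘(ℝ, Fin N → ℂ) ∞ (comp i) (σ.U i)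
  trans (i j : ι) (x : M) (hi : x ∈ σ.U i) (hj : x ∈ σ.U j) :
    comp i x = ρ (σ.s i j x) *ᵥ comp j x

namespace SpinorField

variable {n N : ℕ} {M : Type*} [TopologicalSpace M]
  [ChartedSpace (EuclideanSpace ℝ (Fin n)) M] [IsManifold (𝓡 n) ∞ M]
  {g : PseudoRiemannianMetric n M} {η : Fin n → ℤˣ} {ι : Type*} {σ : SpinStructure g η ι}
  {ρ : CliffordAlgebra (signQuadraticForm η) →ₐ[ℝ] Matrix (Fin N) (Fin N) ℂ}

/-- The spinor field `Ω ^ w • ψ` on `(M, Ω² g)`, for a spinor field `ψ` on `(M, g)`. -/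
def rescale (ψ : SpinorField σ ρ) (Ω : M → ℝ)
    (hΩ : ContMDiff (𝓡 n) 𝓘(ℝ) ∞ Ω) (hpos : ∀ x, 0 < Ω x) (w : ℝ) :
    SpinorField (σ.conformal Ω hΩ hpos) ρ where
  comp i x := (Ω x) ^ w • ψ.comp i x
  smooth i := by
    have h : ContMDiff (𝓡 n) 𝓘(ℝ) ∞ (fun x ↦ (Ω x) ^ w) := fun x ↦
      ((Real.contDiffAt_rpow_const_of_ne (hpos x).ne').contMDiffAt).comp x (hΩ x)
    exact h.contMDiffOn.smul (ψ.smooth i)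
  trans i j x hi hj := by
    rw [ψ.trans i j x hi hj, Matrix.mulVec_smul]
    rfl

/-- The spinor covariant derivative `∇_{e_a} ψ = e_a(ψ) + ¼ ∑ ω_{abc} γ^b γ^c ψ` in the frame
`e i`, where `γ^b = η_b γ_b`. -/
def covDeriv (ψ : SpinorField σ ρ) (i : ι) (a : Fin n) (x : M) : Fin N → ℂ :=
  mvfderiv (𝓡 n) (ψ.comp i) x (σ.e i a x)
    + (1 / 4 : ℝ) • ∑ b, ∑ c, (((η b : ℤ) : ℝ) * ((η c : ℤ) : ℝ) * σ.spinConnection i a b c x) •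
        ((gammaMatrix ρ b * gammaMatrix ρ c) *ᵥ ψ.comp i x)

/-- The Dirac operator `D ψ = ∑ γ^a ∇_{e_a} ψ`: its components in the frame `e i`. -/
def dirac (ψ : SpinorField σ ρ) (i : ι) (x : M) : Fin N → ℂ :=
  ∑ a, ((η a : ℤ) : ℝ) • (gammaMatrix ρ a *ᵥ ψ.covDeriv i a x)

/-- `ψ` solves the Dirac equation `D ψ = 0`. -/
def IsDiracSolution (ψ : SpinorField σ ρ) : Prop :=
  ∀ i, ∀ x ∈ σ.U i, ψ.dirac i x = 0

/-- The function `φ̄ ψ` on `M`, where `φ̄ = φ† A` is the Dirac conjugate. It is computed in any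
of the frames at `x`. -/
def pairing (A : Matrix (Fin N) (Fin N) ℂ) (φ ψ : SpinorField σ ρ) (x : M) : ℂ :=
  star (φ.comp (σ.cover x).choose x) ⬝ᵥ (A *ᵥ ψ.comp (σ.cover x).choose x)

/-- The function `φ̄ (γ · T) ψ` at `x`, for a tangent vector `T` at `x`; here
`γ · T = ∑ a, T^a γ_a` with the components `T^a = η_a g(T, e_a)` of `T`. -/
def normalPairing (A : Matrix (Fin N) (Fin N) ℂ) (φ ψ : SpinorField σ ρ) (x : M)
    (T : TangentSpace (𝓡 n) x) : ℂ :=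
  star (φ.comp (σ.cover x).choose x) ⬝ᵥ (A *ᵥ
    ((∑ a, (((η a : ℤ) : ℝ) * g.val x T (σ.e (σ.cover x).choose a x)) • gammaMatrix ρ a) *ᵥ
      ψ.comp (σ.cover x).choose x))

end SpinorField

/-- `A` defines a Dirac conjugation `φ̄ = φ† A`: it is invertible and `φ̄ ψ` is invariant under the
spin group. (The usual choices, with `γ_a† A = ± A γ_a` and one sign for all `a`, have this
property.) -/
def IsDiracConjugation {n N : ℕ} {η : Fin n → ℤˣ}
    (ρ : CliffordAlgebra (signQuadraticForm η) →ₐ[ℝ] Matrix (Fin N) (Fin N) ℂ)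
    (A : Matrix (Fin N) (Fin N) ℂ) : Prop :=
  IsUnit A ∧ ∀ s ∈ spinGroup (signQuadraticForm η), (ρ s)ᴴ * A * ρ s = A

/-- The function `φ̄ ψ` does not depend on the frame in which it is computed. -/
theorem SpinorField.pairing_eq {n N : ℕ} {M : Type*} [TopologicalSpace M]
    [ChartedSpace (EuclideanSpace ℝ (Fin n)) M] [IsManifold (𝓡 n) ∞ M]
    {g : PseudoRiemannianMetric n M} {η : Fin n → ℤˣ} {ι : Type*} {σ : SpinStructure g η ι}
    {ρ : CliffordAlgebra (signQuadraticForm η) →ₐ[ℝ] Matrix (Fin N) (Fin N) ℂ}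
    {A : Matrix (Fin N) (Fin N) ℂ} (hA : IsDiracConjugation ρ A) (φ ψ : SpinorField σ ρ)
    (i : ι) (x : M) (hi : x ∈ σ.U i) :
    φ.pairing A ψ x = star (φ.comp i x) ⬝ᵥ (A *ᵥ ψ.comp i x) := by
  have hj := (σ.cover x).choose_spec
  have h := hA.2 _ (σ.mem_spin i _ x hi hj)
  rw [φ.trans i _ x hi hj, ψ.trans i _ x hi hj, Matrix.star_mulVec, Matrix.mulVec_mulVec,
    ← Matrix.dotProduct_mulVec, Matrix.mulVec_mulVec, ← Matrix.mul_assoc, h]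
  rfl

/-- The function `φ̄ (γ · T) ψ` does not depend on the frame in which it is computed. -/
theorem SpinorField.normalPairing_eq {n N : ℕ} {M : Type*} [TopologicalSpace M]
    [ChartedSpace (EuclideanSpace ℝ (Fin n)) M] [IsManifold (𝓡 n) ∞ M]
    {g : PseudoRiemannianMetric n M} {η : Fin n → ℤˣ} {ι : Type*} {σ : SpinStructure g η ι}
    {ρ : CliffordAlgebra (signQuadraticForm η) →ₐ[ℝ] Matrix (Fin N) (Fin N) ℂ}
    {A : Matrix (Fin N) (Fin N) ℂ} (hA : IsDiracConjugation ρ A) (φ ψ : SpinorField σ ρ)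
    (i : ι) (x : M) (hi : x ∈ σ.U i) (T : TangentSpace (𝓡 n) x) :
    φ.normalPairing A ψ x T = star (φ.comp i x) ⬝ᵥ (A *ᵥ
      ((∑ a, (((η a : ℤ) : ℝ) * g.val x T (σ.e i a x)) • gammaMatrix ρ a) *ᵥ ψ.comp i x)) := by
  have key (k : ι) (hk : x ∈ σ.U k) :
      ∑ a, (((η a : ℤ) : ℝ) * g.val x T (σ.e k a x)) • σ.e k a x = T := by
    have hη (a : Fin n) : (((η a : ℤ) : ℝ)) * ((η a : ℤ) : ℝ) = 1 := by
      rcases Int.units_eq_one_or (η a) with h | h <;> simp [h]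
    have hli : LinearIndependent ℝ (fun a ↦ σ.e k a x) := by
      rw [Fintype.linearIndependent_iff]
      intro c hc b
      have h1 := congrArg (fun w ↦ g.val x w (σ.e k b x)) hc
      simp [σ.orthonormal k x hk] at h1
      exact h1
    have : FiniteDimensional ℝ (TangentSpace (𝓡 n) x) :=
      inferInstanceAs (FiniteDimensional ℝ (EuclideanSpace ℝ (Fin n)))
    have hspan := hli.span_eq_top_of_card_eq_finrank' (by
      change _ = Module.finrank ℝ (EuclideanSpace ℝ (Fin n)); simp)
    refine sub_eq_zero.1 (g.nondegenerate x _ fun w ↦ ?_)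
    have hw : w ∈ Submodule.span ℝ (Set.range fun a ↦ σ.e k a x) := hspan ▸ Submodule.mem_top
    induction hw using Submodule.span_induction with
    | mem w h =>
      obtain ⟨b, rfl⟩ := h
      simp [σ.orthonormal k x hk]
      rw [mul_right_comm, hη]; simp
    | zero => simp
    | add u v _ _ hu hv => rw [map_add, hu, hv, add_zero]
    | smul c u _ hu => rw [map_smul, hu, smul_zero]
  have hρ (c : Fin n → ℝ) : ∑ a, c a • gammaMatrix ρ a
      = ρ (CliffordAlgebra.ι (signQuadraticForm η) c) := by
    conv_rhs => rw [pi_eq_sum_univ' c]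
    simp only [map_sum, map_smul, gammaMatrix]
  have hj := (σ.cover x).choose_spec
  have h := hA.2 _ (σ.mem_spin i _ x hi hj)
  have ht := congrArg ρ (σ.frame_trans i _ x hi hj _ _ ((key i hi).trans (key _ hj).symm))
  rw [map_mul, map_mul, ← hρ, ← hρ] at ht
  rw [φ.trans i _ x hi hj, ψ.trans i _ x hi hj, Matrix.star_mulVec,
    ← Matrix.dotProduct_mulVec]
  simp only [Matrix.mulVec_mulVec]
  rw [← ht, ← Matrix.mul_assoc, ← Matrix.mul_assoc, h,
    ← Matrix.mulVec_mulVec]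
  rfl

/-! ### Hypersurfaces -/

section Hypersurface

variable {n : ℕ} (m : ℕ) {M : Type*} [TopologicalSpace M]
  [ChartedSpace (EuclideanSpace ℝ (Fin n)) M] [IsManifold (𝓡 n) ∞ M]
  {S : Type*} [TopologicalSpace S] [ChartedSpace (EuclideanSpace ℝ (Fin m)) S]

/-- The matrix of the metric induced on `S` by `f : S → M`, in the chart of `S` at `p`. -/
def inducedGram (g : PseudoRiemannianMetric n M) (f : S → M) (p : S)
    (u : EuclideanSpace ℝ (Fin m)) : Matrix (Fin m) (Fin m) ℝ :=
  Matrix.of fun k l ↦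
    g.val ((f ∘ (extChartAt (𝓡 m) p).symm) u)
      (mfderiv (𝓡 m) (𝓡 n) (f ∘ (extChartAt (𝓡 m) p).symm) u (EuclideanSpace.single k (1 : ℝ)))
      (mfderiv (𝓡 m) (𝓡 n) (f ∘ (extChartAt (𝓡 m) p).symm) u (EuclideanSpace.single l (1 : ℝ)))

/-- The volume measure `√|det h| du` of the induced metric `h`, on the domain of the chart of `S`
at `p`. -/
def chartVolume [MeasurableSpace S] (g : PseudoRiemannianMetric n M) (f : S → M) (p : S) :
    MeasureTheory.Measure S :=
  (((MeasureTheory.volume : MeasureTheory.Measure (EuclideanSpace ℝ (Fin m))).restrict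
      (extChartAt (𝓡 m) p).target).withDensity
    (fun u ↦ ENNReal.ofReal (Real.sqrt |(inducedGram m g f p u).det|))).map
      (extChartAt (𝓡 m) p).symm

/-- The volume measure `dσ` on `S` of the metric induced by `f : S → M`. The chart measures agree
on overlaps, so that their supremum is the measure on `S` that extends all of them. -/
def inducedVolume [MeasurableSpace S] (g : PseudoRiemannianMetric n M) (f : S → M) :
    MeasureTheory.Measure S :=
  ⨆ p : S, chartVolume m g f p

/-- `T` is a unit normal field along `f : S → M`, with `g(T, T) = ε`. -/
def IsUnitNormal (g : PseudoRiemannianMetric n M) (f : S → M) (ε : ℤˣ)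
    (T : Π y : S, TangentSpace (𝓡 n) (f y)) : Prop :=
  ∀ y, g.val (f y) (T y) (T y) = ((ε : ℤ) : ℝ) ∧
    ∀ v : TangentSpace (𝓡 m) y, g.val (f y) (T y) (mfderiv (𝓡 m) (𝓡 n) f y v) = 0

end Hypersurface

end

/-!
Write `G` for the Clifford element with components `u_a = e_a (log Ω)`. By the Koszul formula the
passage from `g` to `Ω² g` changes the connection coefficients of the frames only by terms in `u`,
and `γ_a G + G γ_a = 2 u_a` turns this change into `½ (γ_a G - u_a)` in the spinor connection. Since
`∑ γ^a γ_a = n`, contraction with `γ^a` gives, for every exponent `w`,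

`D̃ (Ω ^ w • ψ) = Ω ^ (w - 1) • (D ψ + (w + (n - 1) / 2) • G ψ)`,

and the gradient term vanishes for `w = -(n - 1) / 2`. On the integrals, the volume of an
`m`-dimensional submanifold scales by `Ω ^ m`, which two fields of total weight `-m` compensate.
-/

section ManifoldDerivative

variable {𝕜 E H M : Type*} [NontriviallyNormedField 𝕜] [NormedAddCommGroup E] [NormedSpace 𝕜 E]
  [TopologicalSpace H] {I : ModelWithCorners 𝕜 E H} [TopologicalSpace M] [ChartedSpace H M]

theorem mvfderiv_comp_apply_of_hasDerivAt {f : M → 𝕜} {x : M} {h : 𝕜 → 𝕜} {h' : 𝕜}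
    (hh : HasDerivAt h h' (f x)) (hf : MDiffAt f x) (v : TangentSpace I x) :
    mvfderiv I (fun y ↦ h (f y)) x v = h' * mvfderiv I f x v := by
  have hcomp : mvfderiv I (fun y ↦ h (f y)) x v = mvfderiv 𝓘(𝕜) h (f x) (mfderiv I 𝓘(𝕜) f x v) :=
    mvfderiv_comp_apply x hh.differentiableAt.mdifferentiableAt hf v
  rw [hcomp, mvfderiv, mfderiv_eq_fderiv, hh.hasFDerivAt.fderiv]
  exact mul_comm _ _

theorem mlieBracket_smul_smul [IsManifold I 2 M] [CompleteSpace E]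
    {u : M → 𝕜} {V W : Π x : M, TangentSpace I x} {x : M}
    (hu : MDiffAt u x) (hV : MDiffAt (T% V) x) (hW : MDiffAt (T% W) x) :
    VectorField.mlieBracket I (u • V) (u • W) x
      = u x ^ 2 • VectorField.mlieBracket I V W x
        + (u x * mvfderiv I u x (V x)) • W x - (u x * mvfderiv I u x (W x)) • V x := by
  rw [VectorField.mlieBracket_smul_right hu hW, VectorField.mlieBracket_smul_left hu hV]
  simp only [Pi.smul_apply', map_smul, smul_eq_mul, smul_add, smul_smul, neg_smul, smul_neg]
  module

theorem mvfderiv_rpow_const_apply {E H M : Type*} [NormedAddCommGroup E] [NormedSpace ℝ E]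
    [TopologicalSpace H] {I : ModelWithCorners ℝ E H} [TopologicalSpace M] [ChartedSpace H M]
    {f : M → ℝ} {x : M} (hf : MDiffAt f x) (hx : f x ≠ 0) (w : ℝ) (v : TangentSpace I x) :
    mvfderiv I (fun y ↦ f y ^ w) x v
      = w * f x ^ w * mvfderiv I (fun y ↦ Real.log (f y)) x v := by
  rw [mvfderiv_comp_apply_of_hasDerivAt (Real.hasDerivAt_rpow_const (Or.inl hx)) hf,
    mvfderiv_comp_apply_of_hasDerivAt (Real.hasDerivAt_log hx) hf, Real.rpow_sub_one hx]
  ring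

end ManifoldDerivative

namespace PseudoRiemannianMetric

variable {n : ℕ} {M : Type*} [TopologicalSpace M]
  [ChartedSpace (EuclideanSpace ℝ (Fin n)) M] [IsManifold (𝓡 n) ∞ M]

theorem mdifferentiableAt_val (g : PseudoRiemannianMetric n M)
    {Y Z : Π x : M, TangentSpace (𝓡 n) x} {x : M}
    (hY : MDifferentiableAt (𝓡 n) (𝓡 n).tangent (T% Y) x)
    (hZ : MDifferentiableAt (𝓡 n) (𝓡 n).tangent (T% Z) x) :
    MDifferentiableAt (𝓡 n) 𝓘(ℝ) (fun y ↦ g.val y (Y y) (Z y)) x := by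
  have h := (g.contMDiff.mdifferentiableAt (by simp)).clm_bundle_apply₂
    (F₁ := EuclideanSpace ℝ (Fin n)) (F₂ := EuclideanSpace ℝ (Fin n)) (F₃ := ℝ)
    (E₃ := Bundle.Trivial M ℝ) hY hZ
  exact ((mdifferentiableAt_totalSpace (𝓡 n) _).1 h).2

variable {g : PseudoRiemannianMetric n M} {X Y Z : Π x : M, TangentSpace (𝓡 n) x} {x : M}

theorem leviCivita_conformal {Ω : M → ℝ} (hΩ : ContMDiff (𝓡 n) 𝓘(ℝ) ∞ Ω) (hpos : ∀ x, 0 < Ω x)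
    (hX : MDifferentiableAt (𝓡 n) (𝓡 n).tangent (T% X) x)
    (hY : MDifferentiableAt (𝓡 n) (𝓡 n).tangent (T% Y) x)
    (hZ : MDifferentiableAt (𝓡 n) (𝓡 n).tangent (T% Z) x) :
    (g.conformal Ω hΩ hpos).leviCivita X Y Z x
      = Ω x ^ 2 * (g.leviCivita X Y Z x
        + mvfderiv (𝓡 n) (fun y ↦ Real.log (Ω y)) x (X x) * g.val x (Y x) (Z x)
        + mvfderiv (𝓡 n) (fun y ↦ Real.log (Ω y)) x (Y x) * g.val x (Z x) (X x)
        - mvfderiv (𝓡 n) (fun y ↦ Real.log (Ω y)) x (Z x) * g.val x (X x) (Y x)) := by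
  have hd {q : M → ℝ} (hq : MDifferentiableAt (𝓡 n) 𝓘(ℝ) q x) (v : TangentSpace (𝓡 n) x) :
      mvfderiv (𝓡 n) (fun y ↦ Ω y ^ 2 * q y) x v = Ω x ^ 2 * (mvfderiv (𝓡 n) q x v
        + 2 * mvfderiv (𝓡 n) (fun y ↦ Real.log (Ω y)) x v * q x) := by
    have hsq := mvfderiv_rpow_const_apply (hΩ.mdifferentiableAt (by simp)) (hpos x).ne' 2 v
    have hmul := DFunLike.congr_fun (mvfderiv_mul (I := 𝓡 n) (f := fun y ↦ Ω y ^ 2)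
      ((hΩ.pow 2).mdifferentiableAt (by simp)) hq) v
    simp only [Real.rpow_two] at hsq
    refine hmul.trans ?_
    simp only [add_apply, smul_apply, smul_eq_mul, hsq]
    ring
  simp only [leviCivita, conformal, smul_apply, smul_eq_mul, hd (g.mdifferentiableAt_val hY hZ),
    hd (g.mdifferentiableAt_val hZ hX), hd (g.mdifferentiableAt_val hX hY)]
  ring

theorem leviCivita_smul_smul_smul {u : M → ℝ} (hu : MDifferentiableAt (𝓡 n) 𝓘(ℝ) u x)
    (hX : MDifferentiableAt (𝓡 n) (𝓡 n).tangent (T% X) x)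
    (hY : MDifferentiableAt (𝓡 n) (𝓡 n).tangent (T% Y) x)
    (hZ : MDifferentiableAt (𝓡 n) (𝓡 n).tangent (T% Z) x) :
    g.leviCivita (u • X) (u • Y) (u • Z) x
      = u x ^ 2 * (u x * g.leviCivita X Y Z x
        + mvfderiv (𝓡 n) u x (X x) * g.val x (Y x) (Z x)) := by
  have hd {q : M → ℝ} (hq : MDifferentiableAt (𝓡 n) 𝓘(ℝ) q x) (v : TangentSpace (𝓡 n) x) :
      mvfderiv (𝓡 n) (fun y ↦ u y * (u y * q y)) x v
        = u x ^ 2 * mvfderiv (𝓡 n) q x v + 2 * u x * mvfderiv (𝓡 n) u x v * q x := by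
    have hmul := DFunLike.congr_fun (mvfderiv_mul hu (hu.mul hq)) v
    refine hmul.trans ?_
    rw [mvfderiv_mul hu hq]
    simp only [add_apply, smul_apply, smul_eq_mul, Pi.mul_apply]
    ring
  simp only [leviCivita, Pi.smul_apply', mlieBracket_smul_smul hu hX hY,
    mlieBracket_smul_smul hu hY hZ, mlieBracket_smul_smul hu hZ hX, map_smul, map_add, map_sub,
    add_apply, sub_apply, smul_apply, smul_eq_mul, hd (g.mdifferentiableAt_val hY hZ),
    hd (g.mdifferentiableAt_val hZ hX), hd (g.mdifferentiableAt_val hX hY)]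
  rw [g.symm x (Y x) (X x), g.symm x (Z x) (Y x), g.symm x (X x) (Z x)]
  ring

end PseudoRiemannianMetric

namespace SpinStructure

variable {n : ℕ} {M : Type*} [TopologicalSpace M]
  [ChartedSpace (EuclideanSpace ℝ (Fin n)) M] [IsManifold (𝓡 n) ∞ M]
  {g : PseudoRiemannianMetric n M} {η : Fin n → ℤˣ} {ι : Type*}

theorem mdifferentiableAt_e (σ : SpinStructure g η ι) {i : ι} {x : M} (hx : x ∈ σ.U i)
    (a : Fin n) : MDifferentiableAt (𝓡 n) (𝓡 n).tangent (T% (σ.e i a)) x :=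
  ((σ.smooth_e i a).contMDiffAt ((σ.isOpen_U i).mem_nhds hx)).mdifferentiableAt (by simp)

/-- The components `e_a(log Ω)` of the logarithmic derivative of `Ω` in the frame `e i`. -/
noncomputable def frameLogDeriv (σ : SpinStructure g η ι) (i : ι) (Ω : M → ℝ) (x : M) :
    Fin n → ℝ :=
  fun a ↦ mvfderiv (𝓡 n) (fun y ↦ Real.log (Ω y)) x (σ.e i a x)

theorem spinConnection_conformal (σ : SpinStructure g η ι) {Ω : M → ℝ}
    (hΩ : ContMDiff (𝓡 n) 𝓘(ℝ) ∞ Ω) (hpos : ∀ x, 0 < Ω x) {i : ι} {x : M} (hx : x ∈ σ.U i)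
    (a b c : Fin n) :
    (σ.conformal Ω hΩ hpos).spinConnection i a b c x
      = (Ω x)⁻¹ * (σ.spinConnection i a b c x
        + (if a = b then ((η a : ℤ) : ℝ) else 0) * σ.frameLogDeriv i Ω x c
        - (if a = c then ((η a : ℤ) : ℝ) else 0) * σ.frameLogDeriv i Ω x b) := by
  have h0 : Ω x ≠ 0 := (hpos x).ne'
  have hinv : MDifferentiableAt (𝓡 n) 𝓘(ℝ) (fun y ↦ (Ω y)⁻¹) x :=
    (hΩ.inv₀ fun y ↦ (hpos y).ne').mdifferentiableAt (by simp)
  have hdinv : mvfderiv (𝓡 n) (fun y ↦ (Ω y)⁻¹) x (σ.e i a x)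
      = -(Ω x)⁻¹ * mvfderiv (𝓡 n) (fun y ↦ Real.log (Ω y)) x (σ.e i a x) := by
    simpa [Real.rpow_neg_one] using
      mvfderiv_rpow_const_apply (hΩ.mdifferentiableAt (by simp)) h0 (-1) (σ.e i a x)
  have he := σ.mdifferentiableAt_e hx
  calc (σ.conformal Ω hΩ hpos).spinConnection i a b c x
      = (Ω x)⁻¹ ^ 2 * ((Ω x)⁻¹ *
            (g.conformal Ω hΩ hpos).leviCivita (σ.e i a) (σ.e i c) (σ.e i b) x
          + mvfderiv (𝓡 n) (fun y ↦ (Ω y)⁻¹) x (σ.e i a x)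
            * (g.conformal Ω hΩ hpos).val x (σ.e i c x) (σ.e i b x)) :=
        PseudoRiemannianMetric.leviCivita_smul_smul_smul hinv (he a) (he c) (he b)
    _ = _ := by
      rw [PseudoRiemannianMetric.leviCivita_conformal hΩ hpos (he a) (he c) (he b), hdinv]
      simp only [PseudoRiemannianMetric.conformal, smul_apply, smul_eq_mul, g.symm x (σ.e i b x),
        σ.orthonormal i x hx, frameLogDeriv, spinConnection]
      field_simp
      ring

end SpinStructure

section GammaMatrix

variable {n N : ℕ} {η : Fin n → ℤˣ}
  (ρ : CliffordAlgebra (signQuadraticForm η) →ₐ[ℝ] Matrix (Fin N) (Fin N) ℂ)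

theorem intCast_units_mul_self {R : Type*} [Ring R] (u : ℤˣ) :
    ((u : ℤ) : R) * ((u : ℤ) : R) = 1 := by
  rw [← Int.cast_mul, Int.units_coe_mul_self, Int.cast_one]

theorem polar_signQuadraticForm (v w : Fin n → ℝ) :
    QuadraticMap.polar (signQuadraticForm η) v w = 2 * ∑ a, ((η a : ℤ) : ℝ) * v a * w a := by
  simp only [QuadraticMap.polar, QuadraticMap.weightedSumSquares_apply, Pi.add_apply, smul_eq_mul,
    ← Finset.sum_sub_distrib, Finset.mul_sum]
  exact Finset.sum_congr rfl fun a _ ↦ by ring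

theorem gammaMatrix_mul_self (a : Fin n) :
    gammaMatrix ρ a * gammaMatrix ρ a = ((η a : ℤ) : ℝ) • 1 := by
  rw [gammaMatrix, ← map_mul, CliffordAlgebra.ι_sq_scalar, AlgHom.commutes,
    Algebra.algebraMap_eq_smul_one]
  simp [QuadraticMap.weightedSumSquares_apply, Pi.single_apply]

theorem sum_gammaMatrix_mul_self :
    ∑ a, ((η a : ℤ) : ℝ) • (gammaMatrix ρ a * gammaMatrix ρ a) = (n : ℝ) • 1 := by
  simp [gammaMatrix_mul_self, smul_smul, intCast_units_mul_self, Nat.cast_smul_eq_nsmul]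

/-- Clifford multiplication `γ^b u_b` by the covector with components `u_b`; the signs `η b` raise
the index of `u`. -/
noncomputable def cliffordMul (u : Fin n → ℝ) : Matrix (Fin N) (Fin N) ℂ :=
  ρ (CliffordAlgebra.ι (signQuadraticForm η) fun b ↦ ((η b : ℤ) : ℝ) * u b)

theorem cliffordMul_eq_sum (u : Fin n → ℝ) :
    cliffordMul ρ u = ∑ b, (((η b : ℤ) : ℝ) * u b) • gammaMatrix ρ b := by
  rw [cliffordMul, pi_eq_sum_univ' fun b ↦ ((η b : ℤ) : ℝ) * u b]
  simp only [map_sum, map_smul, gammaMatrix]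

theorem gammaMatrix_mul_cliffordMul_add_swap (a : Fin n) (u : Fin n → ℝ) :
    gammaMatrix ρ a * cliffordMul ρ u + cliffordMul ρ u * gammaMatrix ρ a = (2 * u a) • 1 := by
  rw [gammaMatrix, cliffordMul, ← map_mul ρ, ← map_mul ρ, ← map_add ρ,
    CliffordAlgebra.ι_mul_ι_add_swap, AlgHom.commutes, Algebra.algebraMap_eq_smul_one,
    polar_signQuadraticForm]
  simp [Pi.single_apply, ← mul_assoc, intCast_units_mul_self]

theorem gammaMatrix_mul_cliffordMul_sub_swap (a : Fin n) (u : Fin n → ℝ) :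
    gammaMatrix ρ a * cliffordMul ρ u - cliffordMul ρ u * gammaMatrix ρ a
      = (2 : ℝ) • (gammaMatrix ρ a * cliffordMul ρ u - u a • 1) := by
  rw [eq_sub_of_add_eq' (gammaMatrix_mul_cliffordMul_add_swap ρ a u)]
  module

theorem sum_sum_diag_left_smul_gammaMatrix_mul (a : Fin n) (u : Fin n → ℝ) :
    ∑ b, ∑ c, (((η b : ℤ) : ℝ) * ((η c : ℤ) : ℝ) * ((if a = b then ((η a : ℤ) : ℝ) else 0) * u c)) •
        (gammaMatrix ρ b * gammaMatrix ρ c)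
      = gammaMatrix ρ a * cliffordMul ρ u := by
  simp only [cliffordMul_eq_sum, Finset.mul_sum, mul_smul_comm]
  rw [Finset.sum_eq_single a (fun b _ hb ↦ by simp [hb.symm]) (by simp)]
  refine Finset.sum_congr rfl fun c _ ↦ congrArg (· • _) ?_
  rw [if_pos rfl]
  linear_combination ((η c : ℤ) : ℝ) * u c * intCast_units_mul_self (R := ℝ) (η a)

theorem sum_sum_diag_right_smul_gammaMatrix_mul (a : Fin n) (u : Fin n → ℝ) :
    ∑ b, ∑ c, (((η b : ℤ) : ℝ) * ((η c : ℤ) : ℝ) * ((if a = c then ((η a : ℤ) : ℝ) else 0) * u b)) •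
        (gammaMatrix ρ b * gammaMatrix ρ c)
      = cliffordMul ρ u * gammaMatrix ρ a := by
  simp only [cliffordMul_eq_sum, Finset.sum_mul, smul_mul_assoc]
  refine Finset.sum_congr rfl fun b _ ↦ ?_
  rw [Finset.sum_eq_single a (fun c _ hc ↦ by simp [hc.symm]) (by simp), if_pos rfl]
  refine congrArg (· • _) ?_
  linear_combination ((η b : ℤ) : ℝ) * u b * intCast_units_mul_self (R := ℝ) (η a)

end GammaMatrix

namespace SpinStructure

variable {n N : ℕ} {M : Type*} [TopologicalSpace M]
  [ChartedSpace (EuclideanSpace ℝ (Fin n)) M] [IsManifold (𝓡 n) ∞ M]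
  {g : PseudoRiemannianMetric n M} {η : Fin n → ℤˣ} {ι : Type*}

/-- The connection matrix `¼ ω_{abc} γ^b γ^c` of the spinor covariant derivative along `e_a` in
the frame `e i`. -/
noncomputable def connectionMatrix (σ : SpinStructure g η ι)
    (ρ : CliffordAlgebra (signQuadraticForm η) →ₐ[ℝ] Matrix (Fin N) (Fin N) ℂ)
    (i : ι) (a : Fin n) (x : M) : Matrix (Fin N) (Fin N) ℂ :=
  (1 / 4 : ℝ) • ∑ b, ∑ c, (((η b : ℤ) : ℝ) * ((η c : ℤ) : ℝ) * σ.spinConnection i a b c x) •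
    (gammaMatrix ρ b * gammaMatrix ρ c)

theorem connectionMatrix_conformal (σ : SpinStructure g η ι)
    (ρ : CliffordAlgebra (signQuadraticForm η) →ₐ[ℝ] Matrix (Fin N) (Fin N) ℂ) {Ω : M → ℝ}
    (hΩ : ContMDiff (𝓡 n) 𝓘(ℝ) ∞ Ω) (hpos : ∀ x, 0 < Ω x) {i : ι} {x : M} (hx : x ∈ σ.U i)
    (a : Fin n) :
    (σ.conformal Ω hΩ hpos).connectionMatrix ρ i a x
      = (Ω x)⁻¹ • (σ.connectionMatrix ρ i a x
        + (1 / 2 : ℝ) • (gammaMatrix ρ a * cliffordMul ρ (σ.frameLogDeriv i Ω x)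
          - σ.frameLogDeriv i Ω x a • 1)) := by
  set u := σ.frameLogDeriv i Ω x with hu
  have hcoeff (r s t p q : ℝ) (G : Matrix (Fin N) (Fin N) ℂ) :
      (r * s * ((Ω x)⁻¹ * (t + p - q))) • G
        = (Ω x)⁻¹ • ((r * s * t) • G + (r * s * p) • G - (r * s * q) • G) := by module
  calc (σ.conformal Ω hΩ hpos).connectionMatrix ρ i a x
      = (Ω x)⁻¹ • (σ.connectionMatrix ρ i a x + (1 / 4 : ℝ) •
          (gammaMatrix ρ a * cliffordMul ρ u - cliffordMul ρ u * gammaMatrix ρ a)) := by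
        simp only [connectionMatrix, σ.spinConnection_conformal hΩ hpos hx, ← hu, hcoeff,
          ← Finset.smul_sum, Finset.sum_add_distrib, Finset.sum_sub_distrib,
          sum_sum_diag_left_smul_gammaMatrix_mul,
          sum_sum_diag_right_smul_gammaMatrix_mul]
        module
    _ = _ := by rw [gammaMatrix_mul_cliffordMul_sub_swap]; module

end SpinStructure

namespace SpinorField

variable {n N : ℕ} {M : Type*} [TopologicalSpace M]
  [ChartedSpace (EuclideanSpace ℝ (Fin n)) M] [IsManifold (𝓡 n) ∞ M]
  {g : PseudoRiemannianMetric n M} {η : Fin n → ℤˣ} {ι : Type*} {σ : SpinStructure g η ι}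
  {ρ : CliffordAlgebra (signQuadraticForm η) →ₐ[ℝ] Matrix (Fin N) (Fin N) ℂ}

theorem covDeriv_eq_add_connectionMatrix_mulVec (ψ : SpinorField σ ρ) (i : ι) (a : Fin n) (x : M) :
    ψ.covDeriv i a x
      = mvfderiv (𝓡 n) (ψ.comp i) x (σ.e i a x) + σ.connectionMatrix ρ i a x *ᵥ ψ.comp i x := by
  simp only [covDeriv, SpinStructure.connectionMatrix, Matrix.smul_mulVec, Matrix.sum_mulVec]

variable {Ω : M → ℝ} (hΩ : ContMDiff (𝓡 n) 𝓘(ℝ) ∞ Ω) (hpos : ∀ x, 0 < Ω x)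

theorem mvfderiv_rescale_comp (ψ : SpinorField σ ρ) (w : ℝ) {i : ι} {x : M} (hx : x ∈ σ.U i)
    (a : Fin n) :
    mvfderiv (𝓡 n) ((ψ.rescale Ω hΩ hpos w).comp i) x ((σ.conformal Ω hΩ hpos).e i a x)
      = (Ω x ^ w * (Ω x)⁻¹) • (mvfderiv (𝓡 n) (ψ.comp i) x (σ.e i a x)
        + (w * σ.frameLogDeriv i Ω x a) • ψ.comp i x) := by
  have h0 := (hpos x).ne'
  have hψ : MDifferentiableAt (𝓡 n) 𝓘(ℝ, Fin N → ℂ) (ψ.comp i) x :=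
    ((ψ.smooth i).contMDiffAt ((σ.isOpen_U i).mem_nhds hx)).mdifferentiableAt (by simp)
  have hΩw : MDifferentiableAt (𝓡 n) 𝓘(ℝ) (fun y ↦ Ω y ^ w) x :=
    (Real.differentiableAt_rpow_const_of_ne w h0).mdifferentiableAt.comp x
      (hΩ.mdifferentiableAt (by simp))
  refine (DFunLike.congr_fun (mvfderiv_smul hΩw hψ) ((Ω x)⁻¹ • σ.e i a x)).trans ?_
  simp only [add_apply, smul_apply, map_smul, ContinuousLinearMap.smulRight_apply,
    mvfderiv_rpow_const_apply (hΩ.mdifferentiableAt (by simp)) h0, SpinStructure.frameLogDeriv]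
  module

theorem covDeriv_rescale (ψ : SpinorField σ ρ) (w : ℝ) {i : ι} {x : M} (hx : x ∈ σ.U i)
    (a : Fin n) :
    (ψ.rescale Ω hΩ hpos w).covDeriv i a x
      = (Ω x ^ w * (Ω x)⁻¹) • (ψ.covDeriv i a x
        + ((w - 1 / 2) * σ.frameLogDeriv i Ω x a) • ψ.comp i x + (1 / 2 : ℝ) •
          (gammaMatrix ρ a *ᵥ cliffordMul ρ (σ.frameLogDeriv i Ω x) *ᵥ ψ.comp i x)) := by
  rw [covDeriv_eq_add_connectionMatrix_mulVec, covDeriv_eq_add_connectionMatrix_mulVec,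
    mvfderiv_rescale_comp hΩ hpos ψ w hx, σ.connectionMatrix_conformal ρ hΩ hpos hx]
  simp only [rescale, Matrix.smul_mulVec, Matrix.add_mulVec, Matrix.sub_mulVec, Matrix.one_mulVec,
    ← Matrix.mulVec_mulVec, Matrix.mulVec_smul]
  module

theorem dirac_rescale (ψ : SpinorField σ ρ) (w : ℝ) {i : ι} {x : M} (hx : x ∈ σ.U i) :
    (ψ.rescale Ω hΩ hpos w).dirac i x
      = Ω x ^ (w - 1) • (ψ.dirac i x + (w + ((n : ℝ) - 1) / 2) •
        (cliffordMul ρ (σ.frameLogDeriv i Ω x) *ᵥ ψ.comp i x)) := by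
  set u := σ.frameLogDeriv i Ω x
  have hgrad : ∑ a, (((η a : ℤ) : ℝ) * u a) • (gammaMatrix ρ a *ᵥ ψ.comp i x)
      = cliffordMul ρ u *ᵥ ψ.comp i x := by
    simp only [cliffordMul_eq_sum, Matrix.sum_mulVec, Matrix.smul_mulVec]
  have hdim (v : Fin N → ℂ) :
      ∑ a, ((η a : ℤ) : ℝ) • (gammaMatrix ρ a *ᵥ gammaMatrix ρ a *ᵥ v) = (n : ℝ) • v := by
    simpa only [Matrix.sum_mulVec, Matrix.smul_mulVec, ← Matrix.mulVec_mulVec, Matrix.one_mulVec]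
      using congrArg (· *ᵥ v) (sum_gammaMatrix_mul_self ρ)
  have hsummand (a : Fin n) :
      ((η a : ℤ) : ℝ) • (gammaMatrix ρ a *ᵥ (ψ.rescale Ω hΩ hpos w).covDeriv i a x)
        = Ω x ^ (w - 1) • (((η a : ℤ) : ℝ) • (gammaMatrix ρ a *ᵥ ψ.covDeriv i a x)
          + (w - 1 / 2) • (((η a : ℤ) : ℝ) * u a) • (gammaMatrix ρ a *ᵥ ψ.comp i x)
          + (1 / 2 : ℝ) • ((η a : ℤ) : ℝ) •
            (gammaMatrix ρ a *ᵥ gammaMatrix ρ a *ᵥ cliffordMul ρ u *ᵥ ψ.comp i x)) := by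
    rw [covDeriv_rescale hΩ hpos ψ w hx, Real.rpow_sub_one (hpos x).ne']
    simp only [Matrix.mulVec_smul, Matrix.mulVec_add]
    module
  simp only [dirac, hsummand, ← Finset.smul_sum, Finset.sum_add_distrib, hgrad, hdim]
  module

theorem dirac_rescale_conformalWeight (ψ : SpinorField σ ρ) {i : ι} {x : M} (hx : x ∈ σ.U i) :
    (ψ.rescale Ω hΩ hpos (-((n : ℝ) - 1) / 2)).dirac i x
      = Ω x ^ (-((n : ℝ) + 1) / 2) • ψ.dirac i x := by
  rw [dirac_rescale hΩ hpos ψ _ hx,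
    show -((n : ℝ) - 1) / 2 + ((n : ℝ) - 1) / 2 = 0 by ring,
    show -((n : ℝ) - 1) / 2 - 1 = -((n : ℝ) + 1) / 2 by ring, zero_smul, add_zero]

theorem isDiracSolution_rescale_iff {ψ : SpinorField σ ρ} :
    (ψ.rescale Ω hΩ hpos (-((n : ℝ) - 1) / 2)).IsDiracSolution ↔ ψ.IsDiracSolution :=
  forall₃_congr fun i x (hx : x ∈ σ.U i) ↦ by
    rw [dirac_rescale_conformalWeight hΩ hpos ψ hx,
      smul_eq_zero_iff_right (Real.rpow_pos_of_pos (hpos x) _).ne']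

variable (A : Matrix (Fin N) (Fin N) ℂ) (φ ψ : SpinorField σ ρ) (w w' : ℝ) (x : M)

theorem pairing_rescale :
    (φ.rescale Ω hΩ hpos w).pairing A (ψ.rescale Ω hΩ hpos w') x
      = Ω x ^ (w + w') • φ.pairing A ψ x := by
  simp only [pairing, rescale, star_smul, star_trivial, Matrix.mulVec_smul, dotProduct_smul,
    smul_dotProduct, smul_smul, Real.rpow_add (hpos x), mul_comm (Ω x ^ w)]
  rfl

theorem normalPairing_rescale (T : TangentSpace (𝓡 n) x) :
    (φ.rescale Ω hΩ hpos w).normalPairing A (ψ.rescale Ω hΩ hpos w') x ((Ω x)⁻¹ • T)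
      = Ω x ^ (w + w') • φ.normalPairing A ψ x T := by
  have hT (a : Fin n) : (g.conformal Ω hΩ hpos).val x ((Ω x)⁻¹ • T)
      ((σ.conformal Ω hΩ hpos).e (σ.cover x).choose a x)
      = g.val x T (σ.e (σ.cover x).choose a x) := by
    have h0 := (hpos x).ne'
    simp only [PseudoRiemannianMetric.conformal, SpinStructure.conformal, map_smul, smul_apply,
      smul_eq_mul]
    field_simp
  simp only [normalPairing, ← hT, rescale, star_smul, star_trivial, Matrix.mulVec_smul,
    dotProduct_smul, smul_dotProduct, smul_smul, Real.rpow_add (hpos x), mul_comm (Ω x ^ w)]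
  rfl

end SpinorField

section WithDensity

open MeasureTheory

variable {α β : Type*} [MeasurableSpace α] [MeasurableSpace β]

theorem withDensity_mono_measure {μ ν : Measure α} (h : μ ≤ ν) (c : α → ENNReal) :
    μ.withDensity c ≤ ν.withDensity c :=
  Measure.le_iff.2 fun s hs ↦ by
    rw [withDensity_apply _ hs, withDensity_apply _ hs]
    exact lintegral_mono' (Measure.restrict_mono le_rfl h) le_rfl

/-- Multiplication of measures by a density with values in `(0, ∞)`, as an automorphism of the
lattice of measures; it therefore commutes with suprema. -/
noncomputable def withDensityOrderIso {c : α → ENNReal} (hc : Measurable c) (h0 : ∀ x, c x ≠ 0)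
    (htop : ∀ x, c x ≠ ⊤) : Measure α ≃o Measure α :=
  Equiv.toOrderIso
    { toFun := fun μ ↦ μ.withDensity c
      invFun := fun μ ↦ μ.withDensity c⁻¹
      left_inv := fun μ ↦ withDensity_inv_same hc (.of_forall h0) (.of_forall htop)
      right_inv := fun μ ↦ by
        simpa only [Pi.inv_apply, inv_inv] using withDensity_inv_same (μ := μ) hc.inv
          (.of_forall fun x ↦ ENNReal.inv_ne_zero.2 (htop x))
          (.of_forall fun x ↦ ENNReal.inv_ne_top.2 (h0 x)) }
    (fun _ _ h ↦ withDensity_mono_measure h _) (fun _ _ h ↦ withDensity_mono_measure h _)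

theorem map_withDensity_comp {μ : Measure α} {f : α → β} (hf : AEMeasurable f μ)
    {c : β → ENNReal} (hc : Measurable c) :
    (μ.withDensity (c ∘ f)).map f = (μ.map f).withDensity c := by
  ext s hs
  rw [Measure.map_apply_of_aemeasurable (hf.mono_ac (withDensity_absolutelyContinuous _ _)) hs,
    withDensity_apply _ hs, withDensity_apply₀ _ (hf.nullMeasurable hs),
    Measure.restrict_map_of_aemeasurable hf hs,
    lintegral_map' hc.aemeasurable (hf.mono_measure Measure.restrict_le_self)]
  rfl

end WithDensity

theorem sqrt_abs_det_sq_smul {k : Type*} [Fintype k] [DecidableEq k] {c : ℝ} (hc : 0 ≤ c)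
    (A : Matrix k k ℝ) :
    Real.sqrt |(c ^ 2 • A).det| = c ^ Fintype.card k * Real.sqrt |A.det| := by
  rw [Matrix.det_smul, abs_mul, pow_right_comm, abs_pow, sq_abs, Real.sqrt_mul (sq_nonneg _),
    Real.sqrt_sq (pow_nonneg hc _)]

section Hypersurface

open MeasureTheory

variable {n m : ℕ} {M : Type*} [TopologicalSpace M]
  [ChartedSpace (EuclideanSpace ℝ (Fin n)) M] [IsManifold (𝓡 n) ∞ M]
  {S : Type*} [TopologicalSpace S] [ChartedSpace (EuclideanSpace ℝ (Fin m)) S]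

theorem continuousOn_mfderiv_apply {F : EuclideanSpace ℝ (Fin m) → M}
    {s : Set (EuclideanSpace ℝ (Fin m))} (hs : IsOpen s) (hF : ContMDiffOn (𝓡 m) (𝓡 n) 1 F s)
    (v : EuclideanSpace ℝ (Fin m)) :
    ContinuousOn (fun u ↦ (⟨F u, mfderiv (𝓡 m) (𝓡 n) F u v⟩ : TangentBundle (𝓡 n) M)) s := by
  have hconst : Continuous
      fun u ↦ (⟨u, v⟩ : TangentBundle (𝓡 m) (EuclideanSpace ℝ (Fin m))) :=
    continuous_iff_continuousAt.2 fun u ↦ ((Bundle.contMDiffAt_section (IB := 𝓡 m) (n := 0)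
      (F := EuclideanSpace ℝ (Fin m)) (E := TangentSpace (𝓡 m) (M := EuclideanSpace ℝ (Fin m)))
      (s := fun _ ↦ v) u).2 (by simpa using contMDiffAt_const)).continuousAt
  refine ((hF.continuousOn_tangentMapWithin le_rfl hs.uniqueMDiffOn).comp hconst.continuousOn
    fun u hu ↦ hu).congr fun u hu ↦ ?_
  simp only [Function.comp_apply, tangentMapWithin, mfderivWithin_of_isOpen hs hu]

theorem inducedGram_conformal (g : PseudoRiemannianMetric n M) {Ω : M → ℝ}
    (hΩ : ContMDiff (𝓡 n) 𝓘(ℝ) ∞ Ω) (hpos : ∀ x, 0 < Ω x) (f : S → M) (p : S)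
    (u : EuclideanSpace ℝ (Fin m)) :
    inducedGram m (g.conformal Ω hΩ hpos) f p u
      = Ω (f ((extChartAt (𝓡 m) p).symm u)) ^ 2 • inducedGram m g f p u := by
  ext k l
  rfl

theorem IsUnitNormal.conformal {g : PseudoRiemannianMetric n M} {Ω : M → ℝ}
    (hΩ : ContMDiff (𝓡 n) 𝓘(ℝ) ∞ Ω) (hpos : ∀ x, 0 < Ω x) {f : S → M} {ε : ℤˣ}
    {T : Π y : S, TangentSpace (𝓡 n) (f y)} (hT : IsUnitNormal m g f ε T) :
    IsUnitNormal m (g.conformal Ω hΩ hpos) f ε (fun y ↦ (Ω (f y))⁻¹ • T y) := by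
  refine fun y ↦ ⟨?_, fun v ↦ ?_⟩
  · have h0 := (hpos (f y)).ne'
    simp only [PseudoRiemannianMetric.conformal, map_smul, smul_apply, (hT y).1, smul_eq_mul]
    field_simp
  · simp only [PseudoRiemannianMetric.conformal, map_smul, smul_apply, (hT y).2 v, smul_zero]

section

variable [IsManifold (𝓡 m) 1 S] (g : PseudoRiemannianMetric n M) {f : S → M}
  (hf : ContMDiff (𝓡 m) (𝓡 n) 1 f)
include hf

theorem continuousOn_inducedGram (p : S) :
    ContinuousOn (inducedGram m g f p) (extChartAt (𝓡 m) p).target := by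
  have hF : ContMDiffOn (𝓡 m) (𝓡 n) 1 (f ∘ (extChartAt (𝓡 m) p).symm)
      (extChartAt (𝓡 m) p).target := hf.comp_contMDiffOn (contMDiffOn_extChartAt_symm p)
  have hv := continuousOn_mfderiv_apply (isOpen_extChartAt_target p) hF
  refine continuousOn_pi.2 fun k ↦ continuousOn_pi.2 fun l u hu ↦ ?_
  have h := ((g.contMDiff.continuous.comp_continuousOn hF.continuousOn).clm_bundle_apply₂
    (F₁ := EuclideanSpace ℝ (Fin n)) (F₂ := EuclideanSpace ℝ (Fin n)) (F₃ := ℝ)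
    (E₃ := Bundle.Trivial M ℝ) (hv (EuclideanSpace.single k 1))
    (hv (EuclideanSpace.single l 1))) u hu
  exact ((FiberBundle.continuousWithinAt_totalSpace _ _).1 h).2

variable [MeasurableSpace S] [BorelSpace S] {Ω : M → ℝ} (hΩ : ContMDiff (𝓡 n) 𝓘(ℝ) ∞ Ω)
  (hpos : ∀ x, 0 < Ω x)

theorem chartVolume_conformal (p : S) :
    chartVolume m (g.conformal Ω hΩ hpos) f p
      = (chartVolume m g f p).withDensity fun y ↦ ((Ω (f y) ^ m).toNNReal : ENNReal) := by
  have hopen := (isOpen_extChartAt_target (I := 𝓡 m) p).measurableSet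
  have hΩf : Measurable fun y ↦ ((Ω (f y) ^ m).toNNReal : ENNReal) :=
    ((hΩ.continuous.comp hf.continuous).pow m).measurable.ennreal_ofReal
  have hsymm : AEMeasurable (extChartAt (𝓡 m) p).symm
      ((volume : Measure (EuclideanSpace ℝ (Fin m))).restrict (extChartAt (𝓡 m) p).target) :=
    (continuousOn_extChartAt_symm p).aemeasurable hopen
  have hgram : AEMeasurable (fun u ↦ ENNReal.ofReal (Real.sqrt |(inducedGram m g f p u).det|))
      ((volume : Measure (EuclideanSpace ℝ (Fin m))).restrict (extChartAt (𝓡 m) p).target) :=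
    ((ENNReal.continuous_ofReal.comp (Real.continuous_sqrt.comp
      (continuous_abs.comp continuous_id.matrix_det))).comp_continuousOn
        (continuousOn_inducedGram g hf p)).aemeasurable hopen
  rw [chartVolume, chartVolume, ← map_withDensity_comp
    (hsymm.mono_ac (withDensity_absolutelyContinuous _ _)) hΩf,
    ← withDensity_mul₀ hgram (hΩf.comp_aemeasurable hsymm)]
  congr 2
  funext u
  have h0 := (hpos (f ((extChartAt (𝓡 m) p).symm u))).le
  rw [inducedGram_conformal, sqrt_abs_det_sq_smul h0, Fintype.card_fin, mul_comm,
    ENNReal.ofReal_mul (Real.sqrt_nonneg _)]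
  rfl

theorem inducedVolume_conformal :
    inducedVolume m (g.conformal Ω hΩ hpos) f
      = (inducedVolume m g f).withDensity fun y ↦ ((Ω (f y) ^ m).toNNReal : ENNReal) := by
  have hΩf : Measurable fun y ↦ ((Ω (f y) ^ m).toNNReal : ENNReal) :=
    ((hΩ.continuous.comp hf.continuous).pow m).measurable.ennreal_ofReal
  have hne (y : S) : ((Ω (f y) ^ m).toNNReal : ENNReal) ≠ 0 := by
    simpa using pow_pos (hpos (f y)) m
  simp only [inducedVolume, chartVolume_conformal g hf hΩ hpos]
  exact ((withDensityOrderIso hΩf hne fun y ↦ ENNReal.coe_ne_top).map_iSup _).symm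

theorem integral_inducedVolume_conformal {E : Type*} [NormedAddCommGroup E] [NormedSpace ℝ E]
    {q q' : S → E} (hq : ∀ y, q' y = Ω (f y) ^ (-(m : ℝ)) • q y) :
    (Integrable q' (inducedVolume m (g.conformal Ω hΩ hpos) f)
      ↔ Integrable q (inducedVolume m g f)) ∧
    ∫ y, q' y ∂(inducedVolume m (g.conformal Ω hΩ hpos) f) = ∫ y, q y ∂(inducedVolume m g f) := by
  have hΩf : Measurable fun y ↦ (Ω (f y) ^ m).toNNReal :=
    ((hΩ.continuous.comp hf.continuous).pow m).measurable.real_toNNReal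
  have hsmul (y : S) : (Ω (f y) ^ m).toNNReal • q' y = q y := by
    have hm := pow_pos (hpos (f y)) m
    rw [hq, NNReal.smul_def, Real.coe_toNNReal _ hm.le, Real.rpow_neg (hpos _).le,
      Real.rpow_natCast, smul_inv_smul₀ hm.ne']
  rw [inducedVolume_conformal g hf hΩ hpos, integrable_withDensity_iff_integrable_smul hΩf,
    integral_withDensity_eq_integral_smul hΩf]
  simp only [hsmul, and_self, iff_self]

end

end Hypersurface

theorem mainTheorem8_general {n N : ℕ} {M : Type*} [TopologicalSpace M]
    [ChartedSpace (EuclideanSpace ℝ (Fin n)) M] [IsManifold (𝓡 n) ∞ M]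
    (g : PseudoRiemannianMetric n M) {η : Fin n → ℤˣ} {ι : Type*} (σ : SpinStructure g η ι)
    (ρ : CliffordAlgebra (signQuadraticForm η) →ₐ[ℝ] Matrix (Fin N) (Fin N) ℂ)
    (Ω : M → ℝ) (hΩ : ContMDiff (𝓡 n) 𝓘(ℝ) ∞ Ω) (hpos : ∀ x, 0 < Ω x) :
    (∀ ψ : SpinorField σ ρ, ∀ i, ∀ x ∈ σ.U i,
      (ψ.rescale Ω hΩ hpos (-((n : ℝ) - 1) / 2)).dirac i x
        = (Ω x) ^ (-((n : ℝ) + 1) / 2) • ψ.dirac i x) ∧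
    (∀ ψ : SpinorField σ ρ,
      (ψ.rescale Ω hΩ hpos (-((n : ℝ) - 1) / 2)).IsDiracSolution ↔ ψ.IsDiracSolution) ∧
    (∀ A : Matrix (Fin N) (Fin N) ℂ, IsDiracConjugation ρ A →
      ∀ (m : ℕ) (w w' : ℝ), w + w' = -m → ∀ (S : Type*) [TopologicalSpace S]
        [ChartedSpace (EuclideanSpace ℝ (Fin m)) S] [IsManifold (𝓡 m) 1 S] [MeasurableSpace S]
        [BorelSpace S] (f : S → M), ContMDiff (𝓡 m) (𝓡 n) 1 f →
        ∀ φ ψ : SpinorField σ ρ,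
        ((MeasureTheory.Integrable
            (fun y ↦ (φ.rescale Ω hΩ hpos w).pairing A (ψ.rescale Ω hΩ hpos w') (f y))
            (inducedVolume m (g.conformal Ω hΩ hpos) f) ↔
          MeasureTheory.Integrable (fun y ↦ φ.pairing A ψ (f y)) (inducedVolume m g f)) ∧
        ∫ y, (φ.rescale Ω hΩ hpos w).pairing A (ψ.rescale Ω hΩ hpos w') (f y)
            ∂(inducedVolume m (g.conformal Ω hΩ hpos) f)
          = ∫ y, φ.pairing A ψ (f y) ∂(inducedVolume m g f)) ∧
        (∀ T : Π y : S, TangentSpace (𝓡 n) (f y),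
          (∀ ε : ℤˣ, IsUnitNormal m g f ε T →
            IsUnitNormal m (g.conformal Ω hΩ hpos) f ε (fun y ↦ (Ω (f y))⁻¹ • T y)) ∧
          (MeasureTheory.Integrable
            (fun y ↦ (φ.rescale Ω hΩ hpos w).normalPairing A (ψ.rescale Ω hΩ hpos w') (f y)
              ((Ω (f y))⁻¹ • T y)) (inducedVolume m (g.conformal Ω hΩ hpos) f) ↔
          MeasureTheory.Integrable (fun y ↦ φ.normalPairing A ψ (f y) (T y))
            (inducedVolume m g f)) ∧
          ∫ y, (φ.rescale Ω hΩ hpos w).normalPairing A (ψ.rescale Ω hΩ hpos w') (f y)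
              ((Ω (f y))⁻¹ • T y) ∂(inducedVolume m (g.conformal Ω hΩ hpos) f)
            = ∫ y, φ.normalPairing A ψ (f y) (T y) ∂(inducedVolume m g f))) := by
  refine ⟨fun ψ i x hx ↦ SpinorField.dirac_rescale_conformalWeight hΩ hpos ψ hx,
    fun ψ ↦ SpinorField.isDiracSolution_rescale_iff hΩ hpos, ?_⟩
  intro A _ m w w' hw S _ _ _ _ _ f hf φ ψ
  exact ⟨integral_inducedVolume_conformal g hf hΩ hpos fun y ↦
      hw ▸ SpinorField.pairing_rescale hΩ hpos A φ ψ w w' (f y),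
    fun T ↦ ⟨fun _ hT ↦ hT.conformal hΩ hpos,
      integral_inducedVolume_conformal g hf hΩ hpos fun y ↦
        hw ▸ SpinorField.normalPairing_rescale hΩ hpos A φ ψ w w' (f y) (T y)⟩⟩

theorem mainTheorem8 {n N : ℕ} {M : Type*} [TopologicalSpace M]
    [ChartedSpace (EuclideanSpace ℝ (Fin n)) M] [IsManifold (𝓡 n) ∞ M]
    (g : PseudoRiemannianMetric n M) {η : Fin n → ℤˣ} {ι : Type*} (σ : SpinStructure g η ι)
    (ρ : CliffordAlgebra (signQuadraticForm η) →ₐ[ℝ] Matrix (Fin N) (Fin N) ℂ)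
    (Ω : M → ℝ) (hΩ : ContMDiff (𝓡 n) 𝓘(ℝ) ∞ Ω) (hpos : ∀ x, 0 < Ω x) :
    -- conformal covariance of the Dirac operator
    (∀ ψ : SpinorField σ ρ, ∀ i, ∀ x ∈ σ.U i,
      (ψ.rescale Ω hΩ hpos (-((n : ℝ) - 1) / 2)).dirac i x
        = (Ω x) ^ (-((n : ℝ) + 1) / 2) • ψ.dirac i x) ∧
    -- solutions of the Dirac equation rescale to solutions
    (∀ ψ : SpinorField σ ρ, ψ.IsDiracSolution →
      (ψ.rescale Ω hΩ hpos (-((n : ℝ) - 1) / 2)).IsDiracSolution) ∧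
    -- the inner products on a hypersurface `f : S → M` are preserved
    (∀ A : Matrix (Fin N) (Fin N) ℂ, IsDiracConjugation ρ A →
      ∀ m : ℕ, m + 1 = n → ∀ (S : Type*) [TopologicalSpace S] [T2Space S]
        [SecondCountableTopology S] [ChartedSpace (EuclideanSpace ℝ (Fin m)) S]
        [IsManifold (𝓡 m) ∞ S] [MeasurableSpace S] [BorelSpace S] (f : S → M),
        ContMDiff (𝓡 m) (𝓡 n) ∞ f →
        (∀ y, Function.Injective (mfderiv (𝓡 m) (𝓡 n) f y)) →
        ∀ φ ψ : SpinorField σ ρ,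
        -- the pairing `∫ φ̄ ψ dσ`
        ((MeasureTheory.Integrable
            (fun y ↦ (φ.rescale Ω hΩ hpos (-((n : ℝ) - 1) / 2)).pairing A
              (ψ.rescale Ω hΩ hpos (-((n : ℝ) - 1) / 2)) (f y))
            (inducedVolume m (g.conformal Ω hΩ hpos) f) ↔
          MeasureTheory.Integrable (fun y ↦ φ.pairing A ψ (f y))
            (inducedVolume m g f)) ∧
        ∫ y, (φ.rescale Ω hΩ hpos (-((n : ℝ) - 1) / 2)).pairing A
              (ψ.rescale Ω hΩ hpos (-((n : ℝ) - 1) / 2)) (f y)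
            ∂(inducedVolume m (g.conformal Ω hΩ hpos) f)
          = ∫ y, φ.pairing A ψ (f y) ∂(inducedVolume m g f)) ∧
        -- the pairing `∫ φ̄ (γ · T) ψ dσ`, for a unit normal field `T`
        (∀ (ε : ℤˣ) (T : Π y : S, TangentSpace (𝓡 n) (f y)), IsUnitNormal m g f ε T →
          IsUnitNormal m (g.conformal Ω hΩ hpos) f ε (fun y ↦ (Ω (f y))⁻¹ • T y) ∧
          (MeasureTheory.Integrable
            (fun y ↦ (φ.rescale Ω hΩ hpos (-((n : ℝ) - 1) / 2)).normalPairing A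
              (ψ.rescale Ω hΩ hpos (-((n : ℝ) - 1) / 2)) (f y) ((Ω (f y))⁻¹ • T y))
            (inducedVolume m (g.conformal Ω hΩ hpos) f) ↔
          MeasureTheory.Integrable (fun y ↦ φ.normalPairing A ψ (f y) (T y))
            (inducedVolume m g f)) ∧
          ∫ y, (φ.rescale Ω hΩ hpos (-((n : ℝ) - 1) / 2)).normalPairing A
              (ψ.rescale Ω hΩ hpos (-((n : ℝ) - 1) / 2)) (f y) ((Ω (f y))⁻¹ • T y)
              ∂(inducedVolume m (g.conformal Ω hΩ hpos) f)
            = ∫ y, φ.normalPairing A ψ (f y) (T y) ∂(inducedVolume m g f))) := by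
  obtain ⟨hdirac, hsol, hint⟩ := mainTheorem8_general g σ ρ Ω hΩ hpos
  refine ⟨hdirac, fun ψ hψ ↦ (hsol ψ).2 hψ, fun A hA m hm S _ _ _ _ _ _ _ f hf _ φ ψ ↦ ?_⟩
  have hw : -((n : ℝ) - 1) / 2 + -((n : ℝ) - 1) / 2 = -m := by rw [← hm]; push_cast; ring
  have : IsManifold (𝓡 m) 1 S := .of_le (n := ∞) (by simp)
  have h := hint A hA m _ _ hw S f (hf.of_le (by simp)) φ ψ
  exact ⟨h.1, fun ε T hT ↦ ⟨(h.2 T).1 ε hT, (h.2 T).2⟩⟩
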